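/- For $n\ge 0$ let $\mathcal I_n(321)$ be the set of permutations $\pi$ of $\{1,\dots,n\}$ with $\pi=\pi^{-1}$ for which there are no $i<j<k$ with $\pi(i)>\pi(j)>\pi(k)$. Let $\mathrm{Des}(\pi)=\{i: 1\le i<n,\ \pi(i)>\pi(i+1)\}$, $\mathrm{des}(\pi)=|\mathrm{Des}(\pi)|$ and $\mathrm{maj}(\pi)=\sum_{i\in\mathrm{Des}(\pi)}i$. For a finite set $S=\{i_1<i_2<\dots<i_k\}$ of positive integers write $\mathbf x^S=x_1^{i_1}x_2^{i_2}\cdots x_k^{i_k}$. Then, in the rings of formal power series $\mathbb Z[[x_1,x_2,\dots]]$ and $\mathbb Z[[t,q]]$ respectively, with limits and infinite sums taken coefficientwise (each coefficient is eventually constant), the series on the right-hand sides converge and $$\lim_{n\to\infty}\sum_{\pi\in\mathcal I_n(321)}\mathbf x^{\mathrm{Des}(\pi)}=\sum_{k\ge0}\frac{x_1x_2^3\cdots x_k^{2k-1}}{(1-x_k)^2(1-x_{k-1}x_k)^2\cdots(1-x_1x_2\cdots x_k)^2},$$ $$\lim_{n\to\infty}\sum_{\pi\in\mathcal I_n(321)}t^{\mathrm{des}(\pi)}q^{\mathrm{maj}(\pi)}=\sum_{k\ge0}\frac{t^kq^{k^2}}{(1-q)^2(1-q^2)^2\cdots(1-q^k)^2}.$$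 -/

import Mathlib

open Filter Topology
open scoped MvPowerSeries.WithPiTopology

namespace Inv321

/-- The permutation `π` contains no `i < j < k` with `π i > π j > π k`. -/
abbrev Avoids321 {n : ℕ} (π : Equiv.Perm (Fin n)) : Prop :=
  ∀ i j k : Fin n, i < j → j < k → ¬ (π i > π j ∧ π j > π k)

/-- The set of `321`-avoiding involutions of an `n`-element set (`π = π⁻¹`). -/
def involutions (n : ℕ) : Finset (Equiv.Perm (Fin n)) :=
  {π : Equiv.Perm (Fin n) | π = π⁻¹ ∧ Avoids321 π}

/-- The descent set, with positions numbered from `1`: the `i` with `1 ≤ i < n` such that the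
`i`-th entry exceeds the `(i+1)`-st. The `i`-th entry of the word is `π a` with `a.val + 1 = i`. -/
def Des {n : ℕ} (π : Equiv.Perm (Fin n)) : Finset ℕ :=
  {i ∈ Finset.Ico 1 n | ∃ a b : Fin n, a.val + 1 = i ∧ b.val + 1 = i + 1 ∧ π a > π b}

/-- The number of descents. -/
def des {n : ℕ} (π : Equiv.Perm (Fin n)) : ℕ := (Des π).card

/-- The major index. -/
def maj {n : ℕ} (π : Equiv.Perm (Fin n)) : ℕ := ∑ i ∈ Des π, i

/-- The variable `x_j` (used for `j ≥ 1` only) of the power series ring `ℤ[[x_1, x_2, …]]`. -/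
noncomputable def x (j : ℕ) : MvPowerSeries ℕ ℤ := MvPowerSeries.X j

/-- `x_1 ^ i_1 ⋯ x_k ^ i_k` for `S = {i_1 < ⋯ < i_k}`. -/
noncomputable def xPow (S : Finset ℕ) : MvPowerSeries ℕ ℤ :=
  ∏ j : Fin S.card, x (j.val + 1) ^ (S.orderEmbOfFin rfl j)

/-- The variable `t` of `ℤ[[t, q]]`. -/
noncomputable def t : MvPowerSeries (Fin 2) ℤ := MvPowerSeries.X 0

/-- The variable `q` of `ℤ[[t, q]]`. -/
noncomputable def q : MvPowerSeries (Fin 2) ℤ := MvPowerSeries.X 1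

/-- The quotient `N / D` of integer power series where `D` has constant term `1`. -/
noncomputable def quot {σ : Type*} (N D : MvPowerSeries σ ℤ) : MvPowerSeries σ ℤ :=
  N * MvPowerSeries.invOfUnit D 1

/-- `quot N D` is the solution of `D * F = N`. -/
theorem mul_quot {σ : Type*} (N D : MvPowerSeries σ ℤ)
    (hD : MvPowerSeries.constantCoeff D = 1) : D * quot N D = N := by
  rw [quot, mul_left_comm, MvPowerSeries.mul_invOfUnit D 1 (by simpa using hD), mul_one]

/-- `(1 - x_k)² (1 - x_{k-1} x_k)² ⋯ (1 - x_1 x_2 ⋯ x_k)²`. -/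
noncomputable def desDenom (k : ℕ) : MvPowerSeries ℕ ℤ :=
  ∏ j ∈ Finset.Icc 1 k, (1 - ∏ i ∈ Finset.Icc j k, x i) ^ 2

/-- `(1 - q)² (1 - q²)² ⋯ (1 - q^k)²`. -/
noncomputable def majDenom (k : ℕ) : MvPowerSeries (Fin 2) ℤ :=
  ∏ i ∈ Finset.Icc 1 k, (1 - q ^ i) ^ 2

theorem constantCoeff_desDenom (k : ℕ) : MvPowerSeries.constantCoeff (desDenom k) = 1 := by
  rw [desDenom, map_prod]
  refine Finset.prod_eq_one fun j hj => ?_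
  have h : ∏ i ∈ Finset.Icc j k, MvPowerSeries.constantCoeff (x i) = 0 :=
    Finset.prod_eq_zero (Finset.left_mem_Icc.2 (Finset.mem_Icc.1 hj).2) (by simp [x])
  simp [h]

theorem constantCoeff_majDenom (k : ℕ) : MvPowerSeries.constantCoeff (majDenom k) = 1 := by
  rw [majDenom, map_prod]
  refine Finset.prod_eq_one fun j hj => ?_
  have h : j ≠ 0 := by have := (Finset.mem_Icc.1 hj).1; omega
  simp [q, h]

/-- `x_1 x_2³ ⋯ x_k^{2k-1} / ((1 - x_k)² (1 - x_{k-1} x_k)² ⋯ (1 - x_1 x_2 ⋯ x_k)²)`. -/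
noncomputable def desTerm (k : ℕ) : MvPowerSeries ℕ ℤ :=
  quot (∏ j ∈ Finset.Icc 1 k, x j ^ (2 * j - 1)) (desDenom k)

/-- `t^k q^{k²} / ((1 - q)² (1 - q²)² ⋯ (1 - q^k)²)`. -/
noncomputable def majTerm (k : ℕ) : MvPowerSeries (Fin 2) ℤ :=
  quot (t ^ k * q ^ (k ^ 2)) (majDenom k)

end Inv321

namespace Inv321

/-! ### Involutions and their excedance sets -/

section Permutations

variable {n : ℕ} {π ρ : Equiv.Perm (Fin n)} {i j : Fin n}

/-! A 321-avoiding involution is a nonnesting partial matching with no fixed point under an arc, so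
its set of openers (excedances) determines it (`excedances_injOn`). Its descents are the right ends
of the maximal intervals of that set (`Des_eq_peaks_excedances`). Every finite set of positive
integers at most `n / 2` occurs (`exists_excedances_eq`), so the limit is the sum over all finite
sets `A` of positive integers of the weight of `peaks A`. Encode `A` by the lengths of its gaps and
intervals (`runsEquiv`). Lengthening the `j`-th gap or interval by one moves peaks `j, …, k` by one,
giving a factor `z_j ⋯ z_k`; each of the two lengths sums to a geometric series, whence the squares
(`hasSum_seqPow_peaks_runs`). Both identities are specializations of this weight. -/

theorem mem_involutions : π ∈ involutions n ↔ π = π⁻¹ ∧ Avoids321 π := by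
  simp [involutions]

theorem apply_apply_of_mem (h : π ∈ involutions n) (i : Fin n) : π (π i) = i := by
  conv_lhs => rw [(mem_involutions.1 h).1]
  conv_lhs => enter [2]; rw [(mem_involutions.1 h).1]
  simp

/-- Otherwise positions `i < j < π j` carry the values `π i > π j > j`, a 321 pattern. -/
theorem apply_lt_apply_of_lt_apply (h : π ∈ involutions n) (hij : i < j) (hj : j < π j) :
    π i < π j := by
  by_contra hlt
  have hne : π i ≠ π j := fun e => hij.ne (π.injective e)
  have hgt : π i > π j := lt_of_le_of_ne (not_lt.1 hlt) hne.symm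
  refine (mem_involutions.1 h).2 i j (π j) hij hj ⟨hgt, ?_⟩
  rwa [apply_apply_of_mem h]

/-- Otherwise positions `π j < i < j` carry the values `j > π i > π j`. -/
theorem apply_lt_apply_of_apply_le (h : π ∈ involutions n) (hij : i < j) (hi : π i ≤ i) :
    π i < π j := by
  by_contra hlt
  have hne : π i ≠ π j := fun e => hij.ne (π.injective e)
  have hgt : π i > π j := lt_of_le_of_ne (not_lt.1 hlt) hne.symm
  refine (mem_involutions.1 h).2 (π j) i j (hgt.trans_le hi) hij ⟨?_, hgt⟩
  rw [apply_apply_of_mem h]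
  exact hi.trans_lt hij

/-- The positions `i`, numbered from `1`, whose entry exceeds `i`. -/
def excedances (π : Equiv.Perm (Fin n)) : Finset ℕ :=
  {i : Fin n | i < π i}.toFinset.image fun i => i.val + 1

/-- The last elements of the maximal intervals contained in `A`. -/
def peaks (A : Finset ℕ) : Finset ℕ := {i ∈ A | i + 1 ∉ A}

theorem mem_peaks {A : Finset ℕ} {i : ℕ} : i ∈ peaks A ↔ i ∈ A ∧ i + 1 ∉ A := by
  simp [peaks]

theorem mem_excedances {a : ℕ} :
    a ∈ excedances π ↔ ∃ i : Fin n, i < π i ∧ i.val + 1 = a := by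
  simp [excedances]

theorem succ_mem_excedances : i.val + 1 ∈ excedances π ↔ i < π i := by
  rw [mem_excedances]
  constructor
  · rintro ⟨j, hj, e⟩
    rwa [show i = j from Fin.ext (by omega)]
  · exact fun h => ⟨i, h, rfl⟩

theorem bounds_of_mem_excedances {a : ℕ} (h : a ∈ excedances π) : 0 < a ∧ a < n := by
  obtain ⟨i, hi, rfl⟩ := mem_excedances.1 h
  have := (π i).isLt
  have : i.val < (π i).val := hi
  omega

theorem Des_eq_peaks_excedances (h : π ∈ involutions n) : Des π = peaks (excedances π) := by
  ext d
  rw [mem_peaks]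
  simp only [Des, Finset.mem_filter, Finset.mem_Ico]
  constructor
  · rintro ⟨-, a, b, rfl, hb, hab⟩
    have hlt : a < b := Fin.lt_def.2 (by omega)
    rw [← hb, succ_mem_excedances, succ_mem_excedances]
    refine ⟨?_, fun hb' => hab.not_gt (apply_lt_apply_of_lt_apply h hlt hb')⟩
    by_contra ha
    exact hab.not_gt (apply_lt_apply_of_apply_le h hlt (not_lt.1 ha))
  · rintro ⟨hd, hd'⟩
    obtain ⟨h0, hn⟩ := bounds_of_mem_excedances hd
    obtain ⟨a, ha, rfl⟩ := mem_excedances.1 hd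
    refine ⟨⟨h0, hn⟩, a, ⟨a.val + 1, hn⟩, rfl, rfl, ?_⟩
    set b : Fin n := ⟨a.val + 1, hn⟩ with hb
    have hb' : ¬ b < π b := fun hlt => hd' (succ_mem_excedances.2 hlt)
    have hlt : a < b := Fin.lt_def.2 (by simp [hb])
    have hne : π a ≠ π b := fun e => hlt.ne (π.injective e)
    have h1 : b ≤ π a := Fin.le_def.2 (by have := Fin.lt_def.1 ha; simp only [hb]; omega)
    exact lt_of_le_of_ne ((not_lt.1 hb').trans h1) hne.symm

/-- The inductive step of `excedances_injOn`. -/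
theorem apply_not_lt_of_excedances_eq (hπ : π ∈ involutions n) (hρ : ρ ∈ involutions n)
    (he : ∀ i, i < π i ↔ i < ρ i) (ih : ∀ j < i, π j = ρ j) (hi : i < π i) :
    ¬ π i < ρ i := by
  intro hlt
  -- So `ρ (π i) ≤ π i`. Equality puts a fixed point of `ρ` under the arc from `i` to `ρ i`; a value
  -- below `i` contradicts `ih`, the value `i` forces `ρ i = π i`, and a value strictly between
  -- gives nested arcs of `ρ`.
  have hp : ¬ π i < ρ (π i) := by
    rw [← he, apply_apply_of_mem hπ]
    exact hi.not_gt
  rcases (not_lt.1 hp).eq_or_lt with e | hlt'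
  · have := apply_lt_apply_of_apply_le hρ hlt e.le
    rw [e, apply_apply_of_mem hρ] at this
    exact hi.not_gt this
  · rcases lt_trichotomy (ρ (π i)) i with h | h | h
    · have e := ih _ h
      rw [apply_apply_of_mem hρ] at e
      exact h.ne (π.injective e)
    · have e := congrArg ρ h
      rw [apply_apply_of_mem hρ] at e
      exact hlt.ne e
    · have := apply_lt_apply_of_lt_apply hρ h (by rwa [apply_apply_of_mem hρ])
      rw [apply_apply_of_mem hρ] at this
      exact hlt.not_gt this

theorem excedances_injOn : Set.InjOn (excedances (n := n)) (involutions n) := by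
  intro π hπ ρ hρ e
  have he : ∀ i, i < π i ↔ i < ρ i := fun i => by
    rw [← succ_mem_excedances, e, succ_mem_excedances]
  ext1 i
  induction i using WellFoundedLT.induction with
  | _ i ih =>
  by_cases hi : i < π i
  · refine le_antisymm (not_lt.1 ?_) (not_lt.1 ?_)
    · exact apply_not_lt_of_excedances_eq hρ hπ (fun i => (he i).symm)
        (fun j hj => (ih j hj).symm) ((he i).1 hi)
    · exact apply_not_lt_of_excedances_eq hπ hρ he ih hi
  · have hi' : ¬ i < ρ i := fun h => hi ((he i).2 h)
    -- A non-excedance is fixed or has a smaller partner, where the induction hypothesis applies.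
    rcases (not_lt.1 hi).eq_or_lt with e1 | h1
    · rcases (not_lt.1 hi').eq_or_lt with e2 | h2
      · rw [e1, e2]
      · have := ih _ h2
        rw [apply_apply_of_mem hρ] at this
        exact absurd (π.injective (this.trans e1.symm)) h2.ne
    · have := ih _ h1
      rw [apply_apply_of_mem hπ] at this
      have e2 := congrArg ρ this
      rw [apply_apply_of_mem hρ] at e2
      exact e2.symm

end Permutations

/-! ### Nonnesting matchings with prescribed openers -/

section Matching

variable (P : ℕ → Prop)

/-- The partner of the opener `x` in the nonnesting matching with set of openers `P`: the least
closer to the right of `x` and of the partners of all earlier openers. -/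
noncomputable def partner (x : ℕ) : ℕ :=
  sInf {i | ¬ P i ∧ x < i ∧ ∀ y, (hy : y < x) → P y → partner y < i}
termination_by x

variable {P} {M : ℕ}

/-- The bound is proved jointly because it shows that the set under `sInf` is nonempty: `M + x` is
not an opener and exceeds every earlier partner. -/
theorem partner_spec_and_le (hM : ∀ i, P i → i < M) (x : ℕ) (hx : P x) :
    (¬ P (partner P x) ∧ x < partner P x ∧ ∀ y < x, P y → partner P y < partner P x) ∧
      partner P x ≤ M + x := by
  induction x using Nat.strong_induction_on with
  | _ x ih =>
  have hmem : M + x ∈ {i | ¬ P i ∧ x < i ∧ ∀ y, (hy : y < x) → P y → partner P y < i} := by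
    refine ⟨fun h => ?_, ?_, fun y hy hPy => ?_⟩
    · have := hM _ h; omega
    · have := hM _ hx; omega
    · have := (ih y hy hPy).2; omega
  rw [partner]
  exact ⟨Nat.sInf_mem ⟨_, hmem⟩, Nat.sInf_le hmem⟩

theorem exists_partner_ge {x i : ℕ} (hi : ¬ P i) (hxi : x < i) (h : i < partner P x) :
    ∃ y < x, P y ∧ i ≤ partner P y := by
  by_contra! hcon
  rw [partner] at h
  exact Nat.notMem_of_lt_sInf h ⟨hi, hxi, fun y hy hPy => hcon y hy hPy⟩

/-- A position covered by an arc is an opener or a closer. -/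
theorem exists_partner_eq {i : ℕ} (hi : ¬ P i) (x : ℕ) (hxi : x < i) (h : i < partner P x) :
    ∃ y, P y ∧ partner P y = i := by
  induction x using Nat.strong_induction_on with
  | _ x ih =>
  obtain ⟨y, hyx, hPy, hy⟩ := exists_partner_ge hi hxi h
  rcases hy.eq_or_lt with e | hlt
  · exact ⟨y, hPy, e.symm⟩
  · exact ih y hyx (hyx.trans hxi) hlt

/-- Every finite set is the set of openers of a nonnesting matching none of whose arcs covers an
unmatched point. -/
theorem exists_involutive_of_openers (hM : ∀ i, P i → i < M) :
    ∃ f : ℕ → ℕ, Function.Involutive f ∧ (∀ i, P i → i < f i ∧ f i < 2 * M) ∧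
      (∀ i, ¬ P i → f i ≤ i) ∧ (∀ i j, P i → P j → i < j → f i < f j) ∧
      (∀ i j, ¬ P i → ¬ P j → i < j → f i < f j) := by
  classical
  have hp := fun x hx => (partner_spec_and_le hM x hx).1
  have hle := fun x hx => (partner_spec_and_le hM x hx).2
  have hinj : ∀ x y, P x → P y → partner P x = partner P y → x = y := by
    intro x y hx hy e
    rcases lt_trichotomy x y with h | h | h
    · exact absurd e ((hp y hy).2.2 x h hx).ne
    · exact h
    · exact absurd e.symm ((hp x hx).2.2 y h hy).ne
  let f : ℕ → ℕ := fun x =>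
    if P x then partner P x
    else if h : ∃ y, P y ∧ partner P y = x then h.choose else x
  have f1 : ∀ x, P x → f x = partner P x := fun x hx => if_pos hx
  have f2 : ∀ x, P x → f (partner P x) = x := by
    intro x hx
    have h : ∃ y, P y ∧ partner P y = partner P x := ⟨x, hx, rfl⟩
    simp only [f, if_neg (hp x hx).1, dif_pos h]
    exact hinj _ _ h.choose_spec.1 hx h.choose_spec.2
  have f3 : ∀ x, ¬ P x → (¬ ∃ y, P y ∧ partner P y = x) → f x = x := by
    intro x hx h
    simp only [f, if_neg hx, dif_neg h]
  refine ⟨f, fun x => ?_, fun x hx => ?_, fun x hx => ?_, fun x y hx hy hxy => ?_,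
    fun x y hx hy hxy => ?_⟩
  · by_cases hx : P x
    · rw [f1 x hx, f2 x hx]
    · by_cases h : ∃ y, P y ∧ partner P y = x
      · obtain ⟨y, hy, rfl⟩ := h
        rw [f2 y hy, f1 y hy]
      · rw [f3 x hx h, f3 x hx h]
  · rw [f1 x hx]
    have h1 := hM x hx
    have h2 := hle x hx
    exact ⟨(hp x hx).2.1, by omega⟩
  · by_cases h : ∃ y, P y ∧ partner P y = x
    · obtain ⟨y, hy, rfl⟩ := h
      rw [f2 y hy]
      exact (hp y hy).2.1.le
    · rw [f3 x hx h]
  · rw [f1 x hx, f1 y hy]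
    exact (hp y hy).2.2 x hxy hx
  · by_cases h : ∃ z, P z ∧ partner P z = x
    · obtain ⟨z, hz, rfl⟩ := h
      rw [f2 z hz]
      by_cases h' : ∃ z, P z ∧ partner P z = y
      · obtain ⟨w, hw, rfl⟩ := h'
        rw [f2 w hw]
        rcases lt_trichotomy z w with h | h | h
        · exact h
        · subst h; exact absurd hxy (lt_irrefl _)
        · exact absurd hxy ((hp z hz).2.2 w h hw).not_gt
      · rw [f3 y hy h']
        exact (hp z hz).2.1.trans hxy
    · rw [f3 x hx h]
      by_cases h' : ∃ z, P z ∧ partner P z = y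
      · obtain ⟨w, hw, rfl⟩ := h'
        rw [f2 w hw]
        rcases lt_trichotomy x w with h1 | h1 | h1
        · exact h1
        · subst h1; exact absurd hw hx
        -- An unmatched `x` would lie under the arc from `w` to `y`.
        · exact absurd (exists_partner_eq hx w h1 hxy) h
      · rwa [f3 y hy h']

theorem exists_excedances_eq {n : ℕ} {A : Finset ℕ} (hA : ∀ i ∈ A, 0 < i ∧ 2 * i ≤ n) :
    ∃ π ∈ involutions n, excedances π = A := by
  obtain ⟨f, hf, hP, hN, hmP, hmN⟩ := exists_involutive_of_openers (P := fun i => i + 1 ∈ A)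
    (M := n / 2) (fun i hi => by have := hA _ hi; omega)
  have hlt : ∀ i, i < n → f i < n := fun i hi => by
    by_cases h : i + 1 ∈ A
    · have := hP i h; omega
    · have := hN i h; omega
  let g : Fin n → Fin n := fun i => ⟨f i, hlt i i.isLt⟩
  have hg : Function.Involutive g := fun i => Fin.ext (hf i)
  refine ⟨hg.toPerm, mem_involutions.2 ⟨Equiv.ext fun i => rfl, ?_⟩, ?_⟩
  · rintro i j k hij hjk ⟨h1, h2⟩
    have hij' : i.val < j.val := hij
    have hjk' : j.val < k.val := hjk
    have h1' : f j < f i := h1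
    have h2' : f k < f j := h2
    -- Two of the three positions have the same type, and `f` is increasing on each type.
    by_cases pi : i.val + 1 ∈ A <;> by_cases pj : j.val + 1 ∈ A <;>
      by_cases pk : k.val + 1 ∈ A <;>
      first
      | exact (hmP _ _ pi pj hij').not_gt h1'
      | exact (hmP _ _ pj pk hjk').not_gt h2'
      | exact (hmP _ _ pi pk (hij'.trans hjk')).not_gt (h2'.trans h1')
      | exact (hmN _ _ pi pj hij').not_gt h1'
      | exact (hmN _ _ pj pk hjk').not_gt h2'
      | exact (hmN _ _ pi pk (hij'.trans hjk')).not_gt (h2'.trans h1')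
  · ext a
    rw [mem_excedances]
    constructor
    · rintro ⟨i, hi, rfl⟩
      by_contra h
      exact absurd (Fin.lt_def.1 hi) (hN i h).not_gt
    · intro ha
      have h := hA a ha
      refine ⟨⟨a - 1, by omega⟩, ?_, by simp only []; omega⟩
      exact Fin.lt_def.2 (hP (a - 1) (by rwa [Nat.sub_add_cancel h.1])).1

end Matching
end Inv321

namespace Inv321

/-! ### Encoding finite sets by gap and interval lengths -/

section Runs

/-- The set of integers greater than `o` whose maximal intervals are described by a list: `(b, a)`
stands for an interval of length `a + 1` preceded by `b` more missing integers than required. -/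
def runs : ℕ → List (ℕ × ℕ) → Finset ℕ
  | _, [] => ∅
  | o, (b, a) :: l => Finset.Ioc (o + b) (o + b + a + 1) ∪ runs (o + b + a + 2) l

theorem mem_runs_cons {o b a i : ℕ} {l : List (ℕ × ℕ)} :
    i ∈ runs o ((b, a) :: l) ↔
      (o + b < i ∧ i ≤ o + b + a + 1) ∨ i ∈ runs (o + b + a + 2) l := by
  simp [runs]

theorem lt_of_mem_runs {o i : ℕ} {l : List (ℕ × ℕ)} (h : i ∈ runs o l) : o < i := by
  induction l generalizing o with
  | nil => simp [runs] at h
  | cons p l ih =>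
    obtain ⟨b, a⟩ := p
    rcases mem_runs_cons.1 h with h | h
    · omega
    · have := ih h; omega

theorem peaks_runs_cons (o b a : ℕ) (l : List (ℕ × ℕ)) :
    peaks (runs o ((b, a) :: l)) =
      insert (o + b + a + 1) (peaks (runs (o + b + a + 2) l)) := by
  ext i
  have h1 : i ∈ runs (o + b + a + 2) l → o + b + a + 2 < i := lt_of_mem_runs
  have h2 : i + 1 ∈ runs (o + b + a + 2) l → o + b + a + 2 < i + 1 := lt_of_mem_runs
  rw [Finset.mem_insert, mem_peaks, mem_peaks, mem_runs_cons, mem_runs_cons]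
  constructor
  · rintro ⟨h | h, h'⟩
    · left
      push Not at h'
      have := h'.1
      omega
    · exact Or.inr ⟨h, fun h'' => h' (Or.inr h'')⟩
  · rintro (rfl | ⟨h, h'⟩)
    · refine ⟨Or.inl ⟨by omega, le_rfl⟩, ?_⟩
      rintro (h | h)
      · omega
      · have := h2 h; omega
    · refine ⟨Or.inr h, ?_⟩
      rintro (h'' | h'')
      · have := h1 h; omega
      · exact h' h''

theorem runs_injective (o : ℕ) : Function.Injective (runs o) := by
  intro l
  induction l generalizing o with
  | nil =>
    rintro (_ | ⟨⟨b, a⟩, l⟩) h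
    · rfl
    · have : o + b + 1 ∈ runs o [] := h ▸ mem_runs_cons.2 (Or.inl (by omega))
      simp [runs] at this
  | cons p l ih =>
    obtain ⟨b, a⟩ := p
    rintro (_ | ⟨⟨b', a'⟩, l'⟩) h
    · have : o + b + 1 ∈ runs o [] := h ▸ mem_runs_cons.2 (Or.inl (by omega))
      simp [runs] at this
    have key : ∀ i, ((o + b < i ∧ i ≤ o + b + a + 1) ∨ i ∈ runs (o + b + a + 2) l) ↔
        ((o + b' < i ∧ i ≤ o + b' + a' + 1) ∨ i ∈ runs (o + b' + a' + 2) l') := fun i => by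
      rw [← mem_runs_cons, ← mem_runs_cons, h]
    have lt : ∀ {i}, i ∈ runs (o + b + a + 2) l → o + b + a + 2 < i := lt_of_mem_runs
    have lt' : ∀ {i}, i ∈ runs (o + b' + a' + 2) l' → o + b' + a' + 2 < i := lt_of_mem_runs
    have hb : b = b' := by
      rcases (key (o + b + 1)).1 (Or.inl (by omega)) with h1 | h1
      · rcases (key (o + b' + 1)).2 (Or.inl (by omega)) with h2 | h2
        · omega
        · have := lt h2; omega
      · rcases (key (o + b' + 1)).2 (Or.inl (by omega)) with h2 | h2
        · have := lt' h1; omega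
        · have := lt h2; have := lt' h1; omega
    subst hb
    have ha : a = a' := by
      rcases lt_trichotomy a a' with h1 | h1 | h1
      · rcases (key (o + b + a + 2)).2 (Or.inl (by omega)) with h2 | h2
        · omega
        · have := lt h2; omega
      · exact h1
      · rcases (key (o + b + a' + 2)).1 (Or.inl (by omega)) with h2 | h2
        · omega
        · have := lt' h2; omega
    subst ha
    refine congrArg _ (ih (o + b + a + 2) (Finset.ext fun i => ?_))
    constructor
    · intro hi
      rcases (key i).1 (Or.inr hi) with h2 | h2
      · have := lt hi; omega
      · exact h2
    · intro hi
      rcases (key i).2 (Or.inr hi) with h2 | h2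
      · have := lt' hi; omega
      · exact h2

theorem exists_runs_eq (A : Finset ℕ) (o : ℕ) (hA : ∀ i ∈ A, o < i) : ∃ l, runs o l = A := by
  induction A using Finset.strongInduction generalizing o with
  | H A ih =>
  rcases A.eq_empty_or_nonempty with rfl | hne
  · exact ⟨[], rfl⟩
  obtain ⟨c, hc, hmin⟩ : ∃ c ∈ A, ∀ i ∈ A, c ≤ i :=
    ⟨A.min' hne, A.min'_mem hne, fun i hi => A.min'_le i hi⟩
  have hex : ∃ a, c + a + 1 ∉ A := by
    refine ⟨A.max' hne, fun h => ?_⟩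
    have := A.le_max' _ h
    omega
  classical
  obtain ⟨a, ha, hlt⟩ : ∃ a, c + a + 1 ∉ A ∧ ∀ a' < a, c + a' + 1 ∈ A :=
    ⟨Nat.find hex, Nat.find_spec hex, fun a' h => not_not.1 (Nat.find_min hex h)⟩
  have hoc := hA c hc
  obtain ⟨l, hl⟩ := ih {i ∈ A | c + a + 1 < i}
    (Finset.filter_ssubset.2 ⟨c, hc, by omega⟩) (c + a + 1)
    fun i hi => (Finset.mem_filter.1 hi).2
  -- The first interval is `c, …, c + a`; the missing integer `c + a + 1` is the origin for the
  -- rest.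
  refine ⟨(c - 1 - o, a) :: l, Finset.ext fun i => ?_⟩
  rw [mem_runs_cons, show o + (c - 1 - o) + a + 2 = c + a + 1 by omega, hl, Finset.mem_filter]
  constructor
  · rintro (h | h)
    · rcases Nat.eq_or_lt_of_le (show c ≤ i by omega) with rfl | hci
      · exact hc
      · have := hlt (i - c - 1) (by omega)
        rwa [show c + (i - c - 1) + 1 = i by omega] at this
    · exact h.1
  · intro hi
    have h1 := hmin i hi
    rcases lt_trichotomy i (c + a + 1) with h | h | h
    · left; omega
    · exact absurd (h ▸ hi) ha
    · exact Or.inr ⟨hi, h⟩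

/-- Finite sets of positive integers correspond to lists of pairs of natural numbers. -/
noncomputable def runsEquiv : List (ℕ × ℕ) ≃ {A : Finset ℕ // 0 ∉ A} :=
  Equiv.ofBijective (fun l => ⟨runs 0 l, fun h => (lt_of_mem_runs h).false⟩)
    ⟨fun _ _ h => runs_injective 0 (congrArg Subtype.val h), fun A => by
      obtain ⟨l, hl⟩ := exists_runs_eq A.1 0 fun i hi =>
        Nat.pos_of_ne_zero fun h => A.2 (h ▸ hi)
      exact ⟨l, Subtype.ext hl⟩⟩

theorem lt_of_mem_peaks_runs {o b a : ℕ} {l : List (ℕ × ℕ)} :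
    ∀ s ∈ peaks (runs (o + b + a + 2) l), o + b + a + 1 < s := fun s hs => by
  have := lt_of_mem_runs (mem_peaks.1 hs).1
  omega

theorem card_peaks_runs (o : ℕ) (l : List (ℕ × ℕ)) : (peaks (runs o l)).card = l.length := by
  induction l generalizing o with
  | nil => simp [runs, peaks]
  | cons p l ih =>
    obtain ⟨b, a⟩ := p
    rw [peaks_runs_cons, Finset.card_insert_of_notMem fun h => (lt_of_mem_peaks_runs _ h).false, ih,
      List.length_cons]

end Runs

/-! ### Monomial weights of peak sets -/

section Weights

variable {R : Type*} [CommRing R]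

/-- `z_0 ^ i_0 * z_1 ^ i_1 * ⋯` for `S = {i_0 < i_1 < ⋯}`. -/
noncomputable def seqPow (z : ℕ → R) (S : Finset ℕ) : R :=
  ∏ j : Fin S.card, z j ^ (S.orderEmbOfFin rfl j)

theorem seqPow_eq (z : ℕ → R) (S : Finset ℕ) {m : ℕ} (h : S.card = m) :
    seqPow z S = ∏ j : Fin m, z j ^ (S.orderEmbOfFin h j) := by
  subst h; rfl

theorem seqPow_empty (z : ℕ → R) : seqPow z ∅ = 1 := by
  rw [seqPow_eq z ∅ Finset.card_empty, Fin.prod_univ_zero]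

theorem seqPow_insert (z : ℕ → R) {a : ℕ} {S : Finset ℕ} (h : ∀ s ∈ S, a < s) :
    seqPow z (insert a S) = z 0 ^ a * seqPow (fun j => z (j + 1)) S := by
  have hcard : (insert a S).card = S.card + 1 :=
    Finset.card_insert_of_notMem fun ha => (h a ha).false
  have key : (Fin.cons a (S.orderEmbOfFin rfl) : Fin (S.card + 1) → ℕ) =
      (insert a S).orderEmbOfFin hcard := by
    refine Finset.orderEmbOfFin_unique hcard (fun j => ?_) ?_
    · refine Fin.cases (by simp) (fun i => ?_) j
      simp
    · refine Fin.strictMono_cons.2 ⟨fun i => ?_, (S.orderEmbOfFin rfl).strictMono⟩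
      exact h _ (Finset.orderEmbOfFin_mem S rfl i)
  rw [seqPow_eq _ _ hcard, ← key, Fin.prod_univ_succ]
  simp [seqPow]

theorem seqPow_const (y : R) (S : Finset ℕ) : seqPow (fun _ => y) S = y ^ ∑ i ∈ S, i := by
  rw [seqPow, Finset.prod_pow_eq_pow_sum]
  congr 1
  conv_rhs => rw [← Finset.image_orderEmbOfFin_univ S rfl]
  rw [Finset.sum_image fun i _ j _ h => (S.orderEmbOfFin rfl).injective h]

theorem pow_dvd_seqPow (z : ℕ → R) {S : Finset ℕ} {s : ℕ} (hs : s ∈ S) :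
    ∃ j, z j ^ s ∣ seqPow z S := by
  obtain ⟨j, rfl⟩ : ∃ j, S.orderEmbOfFin rfl j = s := by
    rw [← Set.mem_range, Finset.range_orderEmbOfFin]; exact hs
  exact ⟨j, Finset.dvd_prod_of_mem _ (Finset.mem_univ j)⟩

theorem seqPow_peaks_runs_cons (z : ℕ → R) (o b a : ℕ) (l : List (ℕ × ℕ)) :
    seqPow z (peaks (runs o ((b, a) :: l))) =
      z 0 ^ (o + b + a + 1) *
        seqPow (fun j => z (j + 1)) (peaks (runs (o + b + a + 2) l)) := by
  rw [peaks_runs_cons, seqPow_insert z lt_of_mem_peaks_runs]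

/-- Moving the origin by `o` moves each of the `l.length` peaks by `o`. -/
theorem seqPow_peaks_runs (z : ℕ → R) (o : ℕ) (l : List (ℕ × ℕ)) :
    seqPow z (peaks (runs o l)) =
      (∏ j ∈ Finset.range l.length, z j) ^ o * seqPow z (peaks (runs 0 l)) := by
  induction l generalizing z o with
  | nil => simp [runs]
  | cons p l ih =>
    obtain ⟨b, a⟩ := p
    rw [seqPow_peaks_runs_cons, seqPow_peaks_runs_cons, ih, ih _ (0 + b + a + 2),
      List.length_cons, Finset.prod_range_succ']
    ring

end Weights

/-! ### Summation and passage to the limit -/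

section GeneratingFunction

variable {σ : Type*}

/-- Allows products of convergent sums to be expanded as sums over pairs. -/
instance : NonarchimedeanRing (MvPowerSeries σ ℤ) where
  is_nonarchimedean U hU := by
    obtain ⟨I, hI, hIU⟩ :=
      (IsLinearTopology.hasBasis_open_ideal (R := MvPowerSeries σ ℤ)).mem_iff.1 hU
    exact ⟨⟨I.toAddSubgroup, hI⟩, hIU⟩

theorem HasSum.of_eq {ι R : Type*} [AddCommMonoid R] [TopologicalSpace R] {f g : ι → R} {a b : R}
    (h : HasSum f a) (hf : ∀ i, g i = f i) (hb : b = a) : HasSum g b := by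
  rwa [hb, funext hf]

theorem hasSum_seqPow_peaks_runs (k : ℕ) (z : ℕ → MvPowerSeries σ ℤ)
    (hz : ∀ j, MvPowerSeries.constantCoeff (z j) = 0) :
    HasSum (fun v : Fin k → ℕ × ℕ => seqPow z (peaks (runs 0 (List.ofFn v))))
      ((∏ j ∈ Finset.range k, z j ^ (2 * j + 1)) *
        ∏ j ∈ Finset.range k, (∑' i : ℕ, (∏ m ∈ Finset.Ico j k, z m) ^ i) ^ 2) := by
  induction k generalizing z with
  | zero =>
    convert hasSum_fintype (fun v : Fin 0 → ℕ × ℕ => (1 : MvPowerSeries σ ℤ)) using 1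
    · funext v
      simp [runs, peaks, seqPow_empty]
    · simp
  | succ k ih =>
    rw [← (Fin.consEquiv fun _ => ℕ × ℕ).hasSum_iff]
    have hY : Summable fun i : ℕ => (∏ m ∈ Finset.range (k + 1), z m) ^ i := by
      apply MvPowerSeries.WithPiTopology.summable_pow_of_constantCoeff_eq_zero
      rw [map_prod]
      exact Finset.prod_eq_zero (Finset.mem_range.2 k.succ_pos) (hz 0)
    -- One geometric series each for `b` and `a`. The prefactor is the case `b = a = 0`: the first
    -- peak is at `1` and the remaining runs start from origin `2`.
    have h := (hY.hasSum.mul_of_nonarchimedean hY.hasSum).mul_of_nonarchimedean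
      ((ih (fun j => z (j + 1)) fun j => hz _).mul_left
        (z 0 * (∏ m ∈ Finset.range k, z (m + 1)) ^ 2))
    refine HasSum.of_eq h ?_ ?_
    · rintro ⟨⟨b, a⟩, v⟩
      have hv : List.ofFn ((Fin.consEquiv fun _ => ℕ × ℕ) ((b, a), v)) = (b, a) :: List.ofFn v :=
        List.ofFn_cons _ _
      simp only [Function.comp_apply, hv]
      rw [seqPow_peaks_runs_cons, seqPow_peaks_runs, List.length_ofFn, Finset.prod_range_succ']
      ring
    · rw [Finset.prod_range_succ', Finset.prod_range_succ' (fun j => (∑' i : ℕ, _) ^ 2)]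
      have h1 : ∀ j, ∏ m ∈ Finset.Ico (j + 1) (k + 1), z m = ∏ m ∈ Finset.Ico j k, z (m + 1) :=
        fun j => by rw [← Finset.prod_Ico_add' z j k 1]
      have h2 : ∏ j ∈ Finset.range k, z (j + 1) ^ (2 * (j + 1) + 1) =
          (∏ j ∈ Finset.range k, z (j + 1) ^ (2 * j + 1)) *
            (∏ m ∈ Finset.range k, z (m + 1)) ^ 2 := by
        rw [← Finset.prod_pow, ← Finset.prod_mul_distrib]
        exact Finset.prod_congr rfl fun j _ => by ring
      simp only [h1, h2, ← Finset.range_eq_Ico]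
      ring

/-- The sum of the weights `u ^ #S * seqPow z S` of the peak sets `S` of the finite sets of positive
integers with `k` peaks. -/
noncomputable def peakTerm (u : MvPowerSeries σ ℤ) (z : ℕ → MvPowerSeries σ ℤ) (k : ℕ) :
    MvPowerSeries σ ℤ :=
  u ^ k * ((∏ j ∈ Finset.range k, z j ^ (2 * j + 1)) *
    ∏ j ∈ Finset.range k, (∑' i : ℕ, (∏ m ∈ Finset.Ico j k, z m) ^ i) ^ 2)

theorem coeff_mul_seqPow_eq_zero (u : MvPowerSeries σ ℤ) {z : ℕ → MvPowerSeries σ ℤ}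
    (hz : ∀ j, MvPowerSeries.constantCoeff (z j) = 0) {S : Finset ℕ} {s : ℕ} (hs : s ∈ S)
    {d : σ →₀ ℕ} (hd : d.degree < s) : MvPowerSeries.coeff d (u * seqPow z S) = 0 := by
  obtain ⟨j, c, hc⟩ := pow_dvd_seqPow z hs
  apply MvPowerSeries.coeff_of_lt_order
  rw [hc, mul_left_comm]
  refine lt_of_lt_of_le ?_ (le_self_add.trans MvPowerSeries.le_order_mul)
  refine lt_of_lt_of_le (Nat.cast_lt.2 hd) (le_trans ?_ (MvPowerSeries.le_order_pow s))
  simpa only [nsmul_eq_mul] using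
    ENat.self_le_mul_right s (MvPowerSeries.order_ne_zero_iff_constCoeff_eq_zero.2 (hz j))

/-- The maximum of `A` is a peak, so the weight has order at least `a`. Hence only finitely many
sets affect a given coefficient. -/
theorem coeff_mul_seqPow_peaks_eq_zero (u : MvPowerSeries σ ℤ) {z : ℕ → MvPowerSeries σ ℤ}
    (hz : ∀ j, MvPowerSeries.constantCoeff (z j) = 0) {A : Finset ℕ} {a : ℕ} (ha : a ∈ A)
    {d : σ →₀ ℕ} (hd : d.degree < a) : MvPowerSeries.coeff d (u * seqPow z (peaks A)) = 0 := by
  have hne : A.Nonempty := ⟨a, ha⟩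
  refine coeff_mul_seqPow_eq_zero u hz (s := A.max' hne)
    (mem_peaks.2 ⟨A.max'_mem hne, fun h => ?_⟩) (hd.trans_le (A.le_max' a ha))
  have := A.le_max' _ h
  omega

theorem summable_peakTerm_and_tendsto (u : MvPowerSeries σ ℤ) {z : ℕ → MvPowerSeries σ ℤ}
    (hz : ∀ j, MvPowerSeries.constantCoeff (z j) = 0) :
    Summable (peakTerm u z) ∧
      Tendsto (fun n : ℕ => ∑ π ∈ involutions n, u ^ (Des π).card * seqPow z (Des π)) atTop
        (𝓝 (∑' k : ℕ, peakTerm u z k)) := by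
  let f : {A : Finset ℕ // 0 ∉ A} → MvPowerSeries σ ℤ := fun A =>
    u ^ (peaks A.1).card * seqPow z (peaks A.1)
  have hf : Summable f := by
    rw [MvPowerSeries.WithPiTopology.summable_iff_summable_coeff]
    refine fun d => summable_of_hasFiniteSupport (Set.Finite.subset
      (Set.Finite.preimage Subtype.val_injective.injOn
        (Finset.range (d.degree + 1)).powerset.finite_toSet) fun A hA => ?_)
    simp only [Set.mem_preimage, Finset.mem_coe, Finset.mem_powerset]
    intro a ha
    by_contra h
    exact hA (coeff_mul_seqPow_peaks_eq_zero _ hz ha (by simpa using h))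
  obtain ⟨L, hL⟩ := hf
  have hsum : HasSum (peakTerm u z) L := by
    rw [← runsEquiv.hasSum_iff, ← List.equivSigmaTuple.symm.hasSum_iff] at hL
    refine hL.sigma fun k => ?_
    refine HasSum.of_eq ((hasSum_seqPow_peaks_runs k z hz).mul_left (u ^ k)) (fun v => ?_) rfl
    change u ^ (peaks (runs 0 (List.ofFn v))).card * seqPow z (peaks (runs 0 (List.ofFn v))) = _
    rw [card_peaks_runs, List.length_ofFn]
  refine ⟨hsum.summable, ?_⟩
  rw [hsum.tsum_eq, MvPowerSeries.WithPiTopology.tendsto_iff_coeff_tendsto]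
  intro d
  refine tendsto_const_nhds.congr' ?_
  -- Sets affecting the coefficient at `d` have all elements at most `d.degree`, so they are
  -- excedance sets once `2 * d.degree ≤ n`.
  filter_upwards [eventually_ge_atTop (2 * d.degree)] with n hn
  have h1 := (MvPowerSeries.WithPiTopology.hasSum_iff_hasSum_coeff.1 hL) d
  have hzero : ∀ A ∉ ((involutions n).image excedances).subtype (fun A => 0 ∉ A),
      MvPowerSeries.coeff d (f A) = 0 := fun A hA => by
    by_contra h
    refine hA (Finset.mem_subtype.2 (Finset.mem_image.2 (exists_excedances_eq fun i hi => ?_)))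
    refine ⟨Nat.pos_of_ne_zero fun h0 => A.2 (h0 ▸ hi), ?_⟩
    by_contra hlt
    exact h (coeff_mul_seqPow_peaks_eq_zero _ hz hi (by omega))
  have h2 := hasSum_sum_of_ne_finset_zero (L := .unconditional _) hzero
  rw [h1.unique h2, Finset.sum_subtype_of_mem (fun A : Finset ℕ =>
    MvPowerSeries.coeff d (u ^ (peaks A).card * seqPow z (peaks A))) fun A hA h0 => by
      obtain ⟨π, -, rfl⟩ := Finset.mem_image.1 hA
      exact (bounds_of_mem_excedances h0).1.false]
  rw [Finset.sum_image excedances_injOn, map_sum]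
  exact Finset.sum_congr rfl fun π hπ => by rw [Des_eq_peaks_excedances hπ]

theorem quot_eq_of_mul_eq {N D F : MvPowerSeries σ ℤ}
    (hD : MvPowerSeries.constantCoeff D = 1) (h : D * F = N) : quot N D = F := by
  rw [quot, ← h, mul_right_comm, MvPowerSeries.mul_invOfUnit D 1 (by simpa using hD), one_mul]

theorem peakTerm_eq_quot (u : MvPowerSeries σ ℤ) {z : ℕ → MvPowerSeries σ ℤ}
    (hz : ∀ j, MvPowerSeries.constantCoeff (z j) = 0) (k : ℕ) {N D : MvPowerSeries σ ℤ}
    (hD : MvPowerSeries.constantCoeff D = 1)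
    (hN : N = u ^ k * ∏ j ∈ Finset.range k, z j ^ (2 * j + 1))
    (hD' : D = ∏ j ∈ Finset.range k, (1 - ∏ m ∈ Finset.Ico j k, z m) ^ 2) :
    quot N D = peakTerm u z k := by
  apply quot_eq_of_mul_eq hD
  have h : D * ∏ j ∈ Finset.range k, (∑' i : ℕ, (∏ m ∈ Finset.Ico j k, z m) ^ i) ^ 2 = 1 := by
    rw [hD', ← Finset.prod_mul_distrib]
    refine Finset.prod_eq_one fun j hj => ?_
    rw [← mul_pow, MvPowerSeries.WithPiTopology.one_sub_mul_tsum_pow_of_constantCoeff_eq_zero,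
      one_pow]
    rw [map_prod]
    exact Finset.prod_eq_zero (Finset.left_mem_Ico.2 (Finset.mem_range.1 hj)) (hz j)
  rw [peakTerm, hN]
  linear_combination (u ^ k * ∏ j ∈ Finset.range k, z j ^ (2 * j + 1)) * h

theorem desTerm_eq (k : ℕ) : desTerm k = peakTerm 1 (fun j => x (j + 1)) k := by
  refine peakTerm_eq_quot 1 (fun j => by simp [x]) k (constantCoeff_desDenom k) ?_ ?_
  · rw [one_pow, one_mul, Finset.range_eq_Ico,
      show Finset.Icc 1 k = Finset.Ico (0 + 1) (k + 1) from rfl, ← Finset.prod_Ico_add']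
    exact Finset.prod_congr rfl fun j _ => by rw [show 2 * (j + 1) - 1 = 2 * j + 1 by omega]
  · have h : ∀ j, ∏ m ∈ Finset.Ico j k, x (m + 1) = ∏ i ∈ Finset.Icc (j + 1) k, x i :=
      fun j => Finset.prod_Ico_add' x j k 1
    simp only [h]
    rw [desDenom, Finset.range_eq_Ico,
      Finset.prod_Ico_add' (fun j => (1 - ∏ i ∈ Finset.Icc j k, x i) ^ 2) 0 k 1]
    rfl

theorem sum_range_odd (k : ℕ) : ∑ j ∈ Finset.range k, (2 * j + 1) = k ^ 2 := by
  induction k with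
  | zero => rfl
  | succ k ih => rw [Finset.sum_range_succ, ih]; ring

theorem majTerm_eq (k : ℕ) : majTerm k = peakTerm t (fun _ => q) k := by
  refine peakTerm_eq_quot t (fun _ => by simp [q]) k (constantCoeff_majDenom k) ?_ ?_
  · rw [Finset.prod_pow_eq_pow_sum, sum_range_odd]
  · have h : majDenom k = ∏ j ∈ Finset.range k, (1 - q ^ (j + 1)) ^ 2 := by
      rw [Finset.range_eq_Ico, Finset.prod_Ico_add' (fun j => (1 - q ^ j) ^ 2) 0 k 1]
      rfl
    -- The `j`-th factor of `peakTerm` involves `q ^ (k - j)`, so the order is reversed.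
    rw [h, ← Finset.prod_range_reflect]
    refine Finset.prod_congr rfl fun j hj => ?_
    rw [Finset.prod_const, Nat.card_Ico,
      show k - 1 - j + 1 = k - j by have := Finset.mem_range.1 hj; omega]

end GeneratingFunction
end Inv321

theorem mainTheorem10 :
    (Summable Inv321.desTerm ∧
      Tendsto (fun n : ℕ => ∑ π ∈ Inv321.involutions n, Inv321.xPow (Inv321.Des π)) atTop
        (𝓝 (∑' k : ℕ, Inv321.desTerm k))) ∧
    (Summable Inv321.majTerm ∧
      Tendsto (fun n : ℕ => ∑ π ∈ Inv321.involutions n,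
          Inv321.t ^ Inv321.des π * Inv321.q ^ Inv321.maj π) atTop
        (𝓝 (∑' k : ℕ, Inv321.majTerm k))) := by
  have h1 := Inv321.summable_peakTerm_and_tendsto 1 (z := fun j => Inv321.x (j + 1))
    fun j => by simp [Inv321.x]
  have h2 := Inv321.summable_peakTerm_and_tendsto Inv321.t (z := fun _ => Inv321.q)
    fun _ => by simp [Inv321.q]
  rw [← funext Inv321.desTerm_eq] at h1
  rw [← funext Inv321.majTerm_eq] at h2
  simp only [one_pow, one_mul] at h1
  simp only [Inv321.seqPow_const] at h2
  -- `seqPow` of the shifted variables is `xPow` by definition.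
  exact ⟨h1, h2⟩
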